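/- Let $W^2(x)=e^{-x^4}$ on $\mathbb{R}$, let $\|p\|^2=\int_{\mathbb{R}}p^2(x)\,e^{-x^4}\,dx$, and let $P_n$ be the monic polynomial of degree $n$ that is orthogonal, with respect to the weight $e^{-x^4}$, to all polynomials of degree less than $n$. For $\lambda>0$ let $$\langle p,q\rangle_\lambda=\int_{\mathbb{R}}p(x)q(x)\,e^{-x^4}\,dx+\lambda\int_{\mathbb{R}}p'(x)q'(x)\,e^{-x^4}\,dx ,$$ and let $S_{n,\lambda}$ be the monic polynomial that minimizes $\langle Q,Q\rangle_\lambda$ among all monic real polynomials $Q$ of degree $n$. Let $(\lambda_n)_{n\ge 1}$ be a decreasing (not necessarily strictly) sequence of positive real numbers such that $\lambda_{n-2}/\lambda_n\to 1$ and $n^{3/2}\lambda_n\to L\in[0,+\infty]$ as $n\to\infty$. Then $$\lim_{n\to\infty}\frac{\langle S_{n,\lambda_n},S_{n,\lambda_n}\rangle_{\lambda_n}}{\|P_n\|^2}=\begin{cases}1 & \text{if } L=0,\\[2pt] \dfrac{2L}{\sqrt3}\,\varphi\!\left(\dfrac{20L+3\sqrt3}{12L}\right) & \text{if } 0<L<+\infty,\\[2pt]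 +\infty & \text{if } L=+\infty,\end{cases}$$ where $\varphi(x)=x+\sqrt{x^2-1}$. -/

import Mathlib

open Polynomial Filter Topology MeasureTheory

noncomputable section

/-- The Freud weight `W²(x) = exp (-x⁴)` on the real line. -/
def freudWeight (x : ℝ) : ℝ := Real.exp (-x ^ 4)

/-- The inner product of `L²(W²)` on real polynomials: `∫ p q exp (-x⁴) dx`. -/
def freudInner (p q : ℝ[X]) : ℝ := ∫ x : ℝ, p.eval x * q.eval x * freudWeight x

/-- The Sobolev inner product with parameter `c`:
`⟨p, q⟩_c = ∫ p q exp (-x⁴) dx + c ∫ p' q' exp (-x⁴) dx`. -/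
def sobolevInner (c : ℝ) (p q : ℝ[X]) : ℝ :=
  freudInner p q + c * freudInner (derivative p) (derivative q)

/-- `P` is monic of degree `n` and orthogonal, for the weight `exp (-x⁴)`, to all polynomials of
degree less than `n`. -/
def IsMonicFreudOrthogonal (n : ℕ) (P : ℝ[X]) : Prop :=
  P.Monic ∧ P.natDegree = n ∧ ∀ q : ℝ[X], q.degree < n → freudInner P q = 0

/-- `S` is monic of degree `n` and minimizes `⟨Q, Q⟩_c` among all monic polynomials `Q` of
degree `n`. -/
def IsMonicSobolevExtremal (c : ℝ) (n : ℕ) (S : ℝ[X]) : Prop :=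
  S.Monic ∧ S.natDegree = n ∧
    ∀ Q : ℝ[X], Q.Monic → Q.natDegree = n → sobolevInner c S S ≤ sobolevInner c Q Q

/-! ### The integrals converge, and both forms are inner products -/

theorem integrable_pow_mul_freudWeight (k : ℕ) :
    Integrable (fun x : ℝ => x ^ k * freudWeight x) := by
  have h1 : Integrable (fun x : ℝ => x ^ (k : ℝ) * Real.exp (-1 * x ^ 2)) :=
    integrable_rpow_mul_exp_neg_mul_sq one_pos (by
      have : (0 : ℝ) ≤ k := Nat.cast_nonneg k
      linarith)
  have h2 := h1.const_mul (Real.exp 1)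
  refine h2.mono ?_ ?_
  · unfold freudWeight
    exact (by fun_prop : Continuous fun x : ℝ => x ^ k * Real.exp (-x ^ 4)).aestronglyMeasurable
  · refine Eventually.of_forall fun x => ?_
    unfold freudWeight
    rw [Real.rpow_natCast, mul_left_comm, ← Real.exp_add, norm_mul, norm_mul,
      Real.norm_of_nonneg (Real.exp_nonneg _), Real.norm_of_nonneg (Real.exp_nonneg _)]
    refine mul_le_mul_of_nonneg_left (Real.exp_le_exp.2 ?_) (norm_nonneg _)
    nlinarith [sq_nonneg (x ^ 2 - 1), sq_nonneg x]

theorem integrable_eval_mul_freudWeight (p : ℝ[X]) :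
    Integrable (fun x : ℝ => p.eval x * freudWeight x) := by
  induction p using Polynomial.induction_on' with
  | add p q hp hq =>
    simp only [eval_add, add_mul]
    exact hp.add hq
  | monomial k a =>
    simpa [mul_assoc] using (integrable_pow_mul_freudWeight k).const_mul a

theorem integrable_freudInner (p q : ℝ[X]) :
    Integrable (fun x : ℝ => p.eval x * q.eval x * freudWeight x) := by
  simpa using integrable_eval_mul_freudWeight (p * q)

theorem freudInner_comm (p q : ℝ[X]) : freudInner p q = freudInner q p := by
  simp only [freudInner, mul_comm]

theorem freudInner_add_left (p q r : ℝ[X]) :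
    freudInner (p + q) r = freudInner p r + freudInner q r := by
  simp only [freudInner, eval_add, add_mul]
  exact integral_add (integrable_freudInner p r) (integrable_freudInner q r)

theorem freudInner_smul_left (a : ℝ) (p r : ℝ[X]) :
    freudInner (a • p) r = a * freudInner p r := by
  simp only [freudInner, eval_smul, smul_eq_mul, mul_assoc]
  exact integral_const_mul _ _

theorem freudInner_self_nonneg (p : ℝ[X]) : 0 ≤ freudInner p p :=
  integral_nonneg fun _ => mul_nonneg (mul_self_nonneg _) (Real.exp_nonneg _)

theorem freudInner_self_pos {p : ℝ[X]} (hp : p ≠ 0) : 0 < freudInner p p := by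
  obtain ⟨x, hx⟩ : ∃ x : ℝ, p.eval x ≠ 0 := by
    by_contra! h
    exact hp (Polynomial.funext fun x => by simpa using h x)
  have hc : Continuous fun x : ℝ => p.eval x * p.eval x * freudWeight x := by
    unfold freudWeight
    fun_prop
  exact integral_pos_of_integrable_nonneg_nonzero (x := x) hc (integrable_freudInner p p)
    (fun _ => mul_nonneg (mul_self_nonneg _) (Real.exp_nonneg _))
    (mul_ne_zero (mul_self_ne_zero.2 hx) (Real.exp_ne_zero _))

/-- `sobolevInner c` as a bilinear form. -/
def sobolevForm (c : ℝ) : ℝ[X] →ₗ[ℝ] ℝ[X] →ₗ[ℝ] ℝ :=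
  LinearMap.mk₂ ℝ (sobolevInner c)
    (fun p q r => by simp only [sobolevInner, derivative_add, freudInner_add_left]; ring)
    (fun a p q => by
      simp only [sobolevInner, derivative_smul, freudInner_smul_left, smul_eq_mul]; ring)
    (fun p q r => by
      simp only [sobolevInner, derivative_add, freudInner_comm p, freudInner_comm (derivative p),
        freudInner_add_left]; ring)
    (fun a p q => by
      simp only [sobolevInner, derivative_smul, freudInner_comm p, freudInner_comm (derivative p),
        freudInner_smul_left, smul_eq_mul]; ring)

theorem sobolevForm_apply (c : ℝ) (p q : ℝ[X]) : sobolevForm c p q = sobolevInner c p q := rfl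

theorem sobolevInner_zero (p q : ℝ[X]) : sobolevInner 0 p q = freudInner p q := by
  simp [sobolevInner]

theorem sobolevInner_comm (c : ℝ) (p q : ℝ[X]) : sobolevInner c p q = sobolevInner c q p := by
  simp only [sobolevInner, freudInner_comm p, freudInner_comm (derivative p)]

theorem sobolevInner_self_pos {c : ℝ} (hc : 0 ≤ c) {p : ℝ[X]} (hp : p ≠ 0) :
    0 < sobolevInner c p p :=
  add_pos_of_pos_of_nonneg (freudInner_self_pos hp) (mul_nonneg hc (freudInner_self_nonneg _))

theorem sobolevInner_add_self (c : ℝ) (p q : ℝ[X]) :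
    sobolevInner c (p + q) (p + q) =
      sobolevInner c p p + 2 * sobolevInner c p q + sobolevInner c q q := by
  simp only [← sobolevForm_apply, map_add, LinearMap.add_apply]
  simp only [sobolevForm_apply, sobolevInner_comm c q p]
  ring

/-! ### Existence and uniqueness of the two families -/

theorem degree_sub_lt_of_monic {n : ℕ} {p q : ℝ[X]} (hp : p.Monic) (hpn : p.natDegree = n)
    (hq : q.Monic) (hqn : q.natDegree = n) : (q - p).degree < n := by
  have h1 : q.degree = n := by rw [degree_eq_natDegree hq.ne_zero, hqn]
  have h2 : p.degree = n := by rw [degree_eq_natDegree hp.ne_zero, hpn]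
  rw [← h1]
  exact degree_sub_lt_left (h1.trans h2.symm) hq.ne_zero (by rw [hq.leadingCoeff, hp.leadingCoeff])

theorem exists_monic_sobolev_orthogonal {c : ℝ} (hc : 0 ≤ c) (n : ℕ) :
    ∃ S : ℝ[X], S.Monic ∧ S.natDegree = n ∧
      ∀ q : ℝ[X], q.degree < n → sobolevInner c S q = 0 := by
  let V := degreeLT ℝ n
  let T : V →ₗ[ℝ] (V →ₗ[ℝ] ℝ) := (sobolevForm c).domRestrict₁₂ V V
  have hfin : FiniteDimensional ℝ V := (degreeLTEquiv ℝ n).symm.finiteDimensional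
  have hinj : Function.Injective T := by
    rw [← LinearMap.ker_eq_bot, LinearMap.ker_eq_bot']
    intro v hv
    by_contra hne
    have h1 : T v v = 0 := by rw [hv]; rfl
    have h2 : (v : ℝ[X]) ≠ 0 := fun h => hne (Subtype.ext h)
    exact (sobolevInner_self_pos hc h2).ne' h1
  have hsurj : Function.Surjective T :=
    (LinearMap.injective_iff_surjective_of_finrank_eq_finrank
      (Subspace.dual_finrank_eq (K := ℝ) (V := V)).symm).1 hinj
  obtain ⟨r, hr⟩ := hsurj ((sobolevForm c (X ^ n)).domRestrict V)
  have hrd : (r : ℝ[X]).degree < n := mem_degreeLT.1 r.2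
  refine ⟨X ^ n - (r : ℝ[X]), (monic_X_pow n).sub_of_left (by simpa using hrd), ?_, fun q hq => ?_⟩
  · exact natDegree_eq_of_degree_eq_some (by
      rw [degree_sub_eq_left_of_degree_lt (by simpa using hrd), degree_X_pow])
  · have h := LinearMap.congr_fun hr ⟨q, mem_degreeLT.2 hq⟩
    have h' : sobolevForm c r q = sobolevForm c (X ^ n) q := h
    rw [← sobolevForm_apply, map_sub, LinearMap.sub_apply, h', sub_self]

theorem existsUnique_isMonicFreudOrthogonal (n : ℕ) : ∃! P, IsMonicFreudOrthogonal n P := by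
  obtain ⟨P, hP, hPn, hPo⟩ := exists_monic_sobolev_orthogonal le_rfl n
  refine ⟨P, ⟨hP, hPn, fun q hq => by rw [← sobolevInner_zero, hPo q hq]⟩, ?_⟩
  rintro Q ⟨hQ, hQn, hQo⟩
  have hd := degree_sub_lt_of_monic hP hPn hQ hQn
  by_contra hne
  refine (sobolevInner_self_pos le_rfl (sub_ne_zero.2 hne)).ne' ?_
  have h1 := hPo _ hd
  have h2 := hQo _ hd
  rw [← sobolevInner_zero] at h2
  rw [← sobolevForm_apply] at h1 h2 ⊢
  rw [map_sub (sobolevForm 0), LinearMap.sub_apply, h1, h2, sub_self]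

theorem existsUnique_isMonicSobolevExtremal {c : ℝ} (hc : 0 ≤ c) (n : ℕ) :
    ∃! S, IsMonicSobolevExtremal c n S := by
  obtain ⟨S, hS, hSn, hSo⟩ := exists_monic_sobolev_orthogonal hc n
  have key : ∀ Q : ℝ[X], Q.Monic → Q.natDegree = n →
      sobolevInner c Q Q = sobolevInner c S S + sobolevInner c (Q - S) (Q - S) := by
    intro Q hQ hQn
    have h := sobolevInner_add_self c S (Q - S)
    rw [hSo _ (degree_sub_lt_of_monic hS hSn hQ hQn), add_sub_cancel] at h
    linarith
  refine ⟨S, ⟨hS, hSn, fun Q hQ hQn => ?_⟩, ?_⟩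
  · rw [key Q hQ hQn]
    by_cases h : Q - S = 0
    · simp [h, ← sobolevForm_apply]
    · linarith [sobolevInner_self_pos hc h]
  · rintro Q ⟨hQ, hQn, hQm⟩
    by_contra hne
    have h1 := hQm S hS hSn
    rw [key Q hQ hQn] at h1
    linarith [sobolevInner_self_pos hc (sub_ne_zero.2 hne)]

/-- `P_n`: the monic orthogonal polynomial of degree `n` for the weight `exp (-x⁴)`. -/
def freudPoly (n : ℕ) : ℝ[X] := (existsUnique_isMonicFreudOrthogonal n).choose

theorem freudPoly_spec (n : ℕ) : IsMonicFreudOrthogonal n (freudPoly n) :=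
  (existsUnique_isMonicFreudOrthogonal n).choose_spec.1

/-- `S_{n,c}`: the monic polynomial of degree `n` that minimizes `⟨Q, Q⟩_c`; it exists and is
unique for every `c ≥ 0` (an unspecified polynomial if there is no minimizer). -/
def sobolevPoly (c : ℝ) (n : ℕ) : ℝ[X] := Classical.epsilon (IsMonicSobolevExtremal c n)

theorem sobolevPoly_spec {c : ℝ} (hc : 0 ≤ c) (n : ℕ) :
    IsMonicSobolevExtremal c n (sobolevPoly c n) :=
  Classical.epsilon_spec (existsUnique_isMonicSobolevExtremal hc n).exists

/-- The ratio `⟨S_{n,c}, S_{n,c}⟩_c / ‖P_n‖²`. -/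
def normRatio (c : ℝ) (n : ℕ) : ℝ :=
  sobolevInner c (sobolevPoly c n) (sobolevPoly c n) / freudInner (freudPoly n) (freudPoly n)

/-- `φ(x) = x + √(x² - 1)`. -/
def joukowskiPhi (x : ℝ) : ℝ := x + √(x ^ 2 - 1)

end

/-!
Integration by parts shows that `P_n'` is a combination of `P_{n-1}` and `P_{n-3}`, namely
`P_n' = n P_{n-1} + 4 (‖P_n‖² / ‖P_{n-3}‖²) P_{n-3}` (`derivative_freudPoly`). Hence, in the basis
`P_0, P_1, …`, the Sobolev form couples each `P_n` only with `P_{n-2}` and `P_{n+2}`. One step of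
Gaussian elimination then gives, for fixed `c`, a continued fraction for the ratios
`k_n = ⟨S_{n,c}, S_{n,c}⟩_c / ‖P_n‖²` (`normRatio_recurrence`):
`k_n = 1 + c D_n - c² E_n / k_{n-2}`, where `D_n` and `E_n` are explicit in the coefficients `a_n` of
the three-term recurrence `X P_n = P_{n+1} + a_n P_{n-1}`.

The string equation `4 a_n (a_{n+1} + a_n + a_{n-1}) = n` and Freud's liminf/limsup argument give
`a_n ~ √(n / 12)` (`tendsto_freudCoeff_div_sqrt`), so `D_n ~ 20 n^{3/2} / (3 √3)` and
`E_n ~ (4 / 3) n³`. If `n^{3/2} λ_n → L ∈ (0, ∞)`, then for each fixed `i` the step of the continued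
fraction from `k_{n-2i-2}` to `k_{n-2i}` with `c = λ_n` tends to the map
`t ↦ 1 + 20 L / (3 √3) - (4 / 3) L² / t`. The a priori bound `k_n ≥ 1 + c n² / a_n`
(`one_add_sq_div_le_normRatio`) keeps all the `k`'s in a region where this map contracts, and so
`k_n` tends to its larger fixed point, which is the stated limit. The same bound settles
`L = ∞`, and together with `k_n ≤ 1 + c D_n` it settles `L = 0`.
-/

/-! ### The weighted inner product -/

theorem freudInner_add_right (p q r : ℝ[X]) :
    freudInner p (q + r) = freudInner p q + freudInner p r := by
  rw [freudInner_comm, freudInner_add_left, freudInner_comm q, freudInner_comm r]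

theorem freudInner_smul_right (a : ℝ) (p r : ℝ[X]) :
    freudInner p (a • r) = a * freudInner p r := by
  rw [freudInner_comm, freudInner_smul_left, freudInner_comm r]

theorem freudInner_sub_left (p q r : ℝ[X]) :
    freudInner (p - q) r = freudInner p r - freudInner q r := by
  simp only [← sobolevInner_zero, ← sobolevForm_apply, map_sub, LinearMap.sub_apply]

theorem freudInner_sub_right (p q r : ℝ[X]) :
    freudInner p (q - r) = freudInner p q - freudInner p r := by
  rw [freudInner_comm, freudInner_sub_left, freudInner_comm q, freudInner_comm r]

theorem freudInner_mul_comm (p q r : ℝ[X]) : freudInner (r * p) q = freudInner p (r * q) := by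
  simp only [freudInner, eval_mul]
  congr 1; ext x; ring

/-- Integration by parts against the weight, whose logarithmic derivative is `-4x³`. -/
theorem freudInner_derivative_left (p q : ℝ[X]) :
    freudInner (derivative p) q = 4 * freudInner (X ^ 3 * p) q - freudInner p (derivative q) := by
  have hw : ∀ x, HasDerivAt freudWeight (-4 * x ^ 3 * freudWeight x) x := fun x => by
    have h : HasDerivAt (fun x : ℝ => Real.exp (-x ^ 4)) _ x := ((hasDerivAt_pow 4 x).fun_neg).exp
    refine h.congr_deriv ?_
    simp only [freudWeight]; push_cast; ring
  have hd : ∀ x, HasDerivAt (fun x : ℝ => (p * q).eval x * freudWeight x)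
      ((derivative (p * q) - (4 : ℝ) • (X ^ 3 * p * q)).eval x * freudWeight x) x := fun x => by
    refine (((p * q).hasDerivAt x).fun_mul (hw x)).congr_deriv ?_
    simp only [eval_sub, eval_smul, eval_mul, eval_pow, eval_X, smul_eq_mul]; ring
  have h := integral_eq_zero_of_hasDerivAt_of_integrable hd
    (integrable_eval_mul_freudWeight _) (integrable_eval_mul_freudWeight _)
  have h2 : freudInner (derivative p * q + p * derivative q - (4 : ℝ) • (X ^ 3 * p * q)) 1 = 0 := by
    rw [← h]; unfold freudInner; congr 1; ext x; simp
  rw [freudInner_sub_left, freudInner_add_left, freudInner_smul_left] at h2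
  have h3 : ∀ r s : ℝ[X], freudInner (r * s) 1 = freudInner r s := fun r s => by
    simp [freudInner]
  rw [h3, h3, h3] at h2
  linarith

/-! ### Parity -/

theorem freudInner_comp_neg_X (p q : ℝ[X]) :
    freudInner (p.comp (-X)) (q.comp (-X)) = freudInner p q := by
  unfold freudInner
  rw [← integral_neg_eq_self]
  congr 1; ext x
  simp [freudWeight, Even.neg_pow (by decide : Even 4)]

theorem sobolevInner_comp_neg_X (c : ℝ) (p q : ℝ[X]) :
    sobolevInner c (p.comp (-X)) (q.comp (-X)) = sobolevInner c p q := by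
  have h : ∀ r : ℝ[X], derivative (r.comp (-X)) = (-1 : ℝ) • (derivative r).comp (-X) := fun r => by
    simp [derivative_comp]
  simp only [sobolevInner, h, freudInner_smul_left, freudInner_smul_right, freudInner_comp_neg_X]
  ring

/-- `p` has the parity of `n`: it is even if `n` is, and odd if `n` is. -/
def HasParity (n : ℕ) (p : ℝ[X]) : Prop := p.comp (-X) = (-1 : ℝ) ^ n • p

theorem sobolevInner_eq_zero_of_hasParity (c : ℝ) {n : ℕ} {p q : ℝ[X]} (hp : HasParity n p)
    (hq : HasParity (n + 1) q) : sobolevInner c p q = 0 := by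
  have h := sobolevInner_comp_neg_X c p q
  rw [hp, hq, ← sobolevForm_apply, ← sobolevForm_apply, map_smul, map_smul, LinearMap.smul_apply,
    smul_eq_mul, smul_eq_mul, ← mul_assoc, ← pow_add] at h
  rw [← sobolevForm_apply]
  have h1 : (-1 : ℝ) ^ (n + 1 + n) = -1 := Odd.neg_one_pow ⟨n, by ring⟩
  rw [h1] at h
  linarith

theorem freudInner_eq_zero_of_hasParity {n : ℕ} {p q : ℝ[X]} (hp : HasParity n p)
    (hq : HasParity (n + 1) q) : freudInner p q = 0 := by
  rw [← sobolevInner_zero, sobolevInner_eq_zero_of_hasParity 0 hp hq]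

theorem HasParity.X_mul {n : ℕ} {p : ℝ[X]} (hp : HasParity n p) : HasParity (n + 1) (X * p) := by
  unfold HasParity at *
  rw [mul_comp, hp, X_comp, pow_succ]
  simp

/-- Reflecting a monic polynomial and correcting the sign gives a monic polynomial. -/
theorem Polynomial.Monic.reflect {n : ℕ} {p : ℝ[X]} (hp : p.Monic) (hn : p.natDegree = n) :
    ((-1 : ℝ) ^ n • p.comp (-X)).Monic ∧ ((-1 : ℝ) ^ n • p.comp (-X)).natDegree = n := by
  have h1 : (-1 : ℝ) ^ n ≠ 0 := pow_ne_zero _ (by norm_num)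
  subst hn
  have h := hp.neg_one_pow_natDegree_mul_comp_neg_X
  have h2 : (-1 : ℝ) ^ p.natDegree • p.comp (-X) = (-1) ^ p.natDegree * p.comp (-X) := by
    rw [smul_eq_C_mul]; simp
  refine ⟨h2 ▸ h, ?_⟩
  rw [natDegree_smul _ h1]
  simp [natDegree_comp]

/-- A minimizer over the monic polynomials of a reflection invariant form has a parity, because
its reflection is a minimizer too. -/
theorem IsMonicSobolevExtremal.hasParity {c : ℝ} (hc : 0 ≤ c) {n : ℕ} {S : ℝ[X]}
    (hS : IsMonicSobolevExtremal c n S) : HasParity n S := by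
  obtain ⟨hm, hn, hmin⟩ := hS
  have hr := hm.reflect hn
  have hsq : (-1 : ℝ) ^ n * (-1) ^ n = 1 := by rw [← mul_pow]; simp
  have h : IsMonicSobolevExtremal c n ((-1 : ℝ) ^ n • S.comp (-X)) := by
    refine ⟨hr.1, hr.2, fun Q hQ hQn => ?_⟩
    have : sobolevInner c ((-1 : ℝ) ^ n • S.comp (-X)) ((-1 : ℝ) ^ n • S.comp (-X))
        = sobolevInner c S S := by
      rw [← sobolevInner_comp_neg_X c S S]
      simp only [← sobolevForm_apply, map_smul, LinearMap.smul_apply, smul_eq_mul]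
      rw [← mul_assoc, hsq, one_mul]
    rw [this]; exact hmin Q hQ hQn
  have h2 := (existsUnique_isMonicSobolevExtremal hc n).unique h ⟨hm, hn, hmin⟩
  unfold HasParity
  conv_rhs => rw [← h2]
  rw [smul_smul, hsq, one_smul]

/-! ### Orthogonality and minimality -/

theorem isMonicSobolevExtremal_of_orthogonal {c : ℝ} (hc : 0 ≤ c) {n : ℕ} {S : ℝ[X]} (hS : S.Monic)
    (hn : S.natDegree = n) (ho : ∀ q : ℝ[X], q.degree < n → sobolevInner c S q = 0) :
    IsMonicSobolevExtremal c n S := by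
  refine ⟨hS, hn, fun Q hQ hQn => ?_⟩
  have h := sobolevInner_add_self c S (Q - S)
  rw [add_sub_cancel, ho _ (degree_sub_lt_of_monic hS hn hQ hQn)] at h
  have h1 : 0 ≤ sobolevInner c (Q - S) (Q - S) :=
    add_nonneg (freudInner_self_nonneg _) (mul_nonneg hc (freudInner_self_nonneg _))
  linarith

/-- The minimizer is characterized by orthogonality to all polynomials of lower degree. -/
theorem eq_sobolevPoly {c : ℝ} (hc : 0 ≤ c) {n : ℕ} {S : ℝ[X]} (hS : S.Monic)
    (hn : S.natDegree = n) (ho : ∀ q : ℝ[X], q.degree < n → sobolevInner c S q = 0) :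
    S = sobolevPoly c n :=
  (existsUnique_isMonicSobolevExtremal hc n).unique
    (isMonicSobolevExtremal_of_orthogonal hc hS hn ho) (sobolevPoly_spec hc n)

theorem sobolevInner_sobolevPoly_eq_zero {c : ℝ} (hc : 0 ≤ c) {n : ℕ} {q : ℝ[X]}
    (hq : q.degree < n) : sobolevInner c (sobolevPoly c n) q = 0 := by
  obtain ⟨S, hS, hn, ho⟩ := exists_monic_sobolev_orthogonal hc n
  rw [← eq_sobolevPoly hc hS hn ho, ho q hq]

theorem freudPoly_hasParity (n : ℕ) : HasParity n (freudPoly n) := by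
  obtain ⟨hm, hn, ho⟩ := freudPoly_spec n
  exact (isMonicSobolevExtremal_of_orthogonal le_rfl hm hn
    fun q hq => by rw [sobolevInner_zero, ho q hq]).hasParity le_rfl

/-- `‖P_n‖²`. -/
noncomputable def freudNormSq (n : ℕ) : ℝ := freudInner (freudPoly n) (freudPoly n)

theorem freudNormSq_pos (n : ℕ) : 0 < freudNormSq n :=
  freudInner_self_pos (freudPoly_spec n).1.ne_zero

theorem natDegree_freudPoly (n : ℕ) : (freudPoly n).natDegree = n := (freudPoly_spec n).2.1

theorem freudPoly_coeff_self (n : ℕ) : (freudPoly n).coeff n = 1 := by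
  have h := (freudPoly_spec n).1.coeff_natDegree
  rwa [natDegree_freudPoly] at h

theorem degree_sub_coeff_smul_lt {n : ℕ} {P q : ℝ[X]} (hP : P.natDegree ≤ n) (h1 : P.coeff n = 1)
    (hq : q.natDegree ≤ n) : (q - q.coeff n • P).degree < n := by
  rw [degree_lt_iff_coeff_zero]
  intro m hm
  rcases hm.eq_or_lt with rfl | hm
  · simp [h1]
  · rw [coeff_sub, coeff_smul, coeff_eq_zero_of_natDegree_lt (hq.trans_lt hm),
      coeff_eq_zero_of_natDegree_lt (hP.trans_lt hm)]
    simp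

/-- Against a polynomial of degree at most `n`, only its coefficient of `Xⁿ` matters to `P_n`. -/
theorem freudInner_freudPoly {n : ℕ} {q : ℝ[X]} (hq : q.natDegree ≤ n) :
    freudInner (freudPoly n) q = q.coeff n * freudNormSq n := by
  have h := (freudPoly_spec n).2.2 _
    (degree_sub_coeff_smul_lt (natDegree_freudPoly n).le (freudPoly_coeff_self n) hq)
  rw [freudInner_sub_right, freudInner_smul_right] at h
  unfold freudNormSq
  linarith

theorem freudInner_freudPoly_of_lt {n : ℕ} {q : ℝ[X]} (hq : q.natDegree < n) :
    freudInner (freudPoly n) q = 0 := by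
  rw [freudInner_freudPoly hq.le, coeff_eq_zero_of_natDegree_lt hq, zero_mul]

theorem sq_coeff_mul_freudNormSq_le {n : ℕ} {q : ℝ[X]} (hq : q.natDegree ≤ n) :
    q.coeff n ^ 2 * freudNormSq n ≤ freudInner q q := by
  have h := freudInner_self_nonneg (q - q.coeff n • freudPoly n)
  rw [freudInner_sub_left, freudInner_sub_right, freudInner_sub_right, freudInner_smul_left,
    freudInner_smul_right, freudInner_smul_left, freudInner_smul_right,
    freudInner_comm q (freudPoly n), freudInner_freudPoly hq, ← freudNormSq] at h
  nlinarith

/-- A polynomial of degree less than `m` is determined by its products with `P_0, …, P_{m-1}`. -/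
theorem eq_zero_of_freudInner_freudPoly {m : ℕ} {q : ℝ[X]} (hq : q.degree < m)
    (h : ∀ k < m, freudInner (freudPoly k) q = 0) : q = 0 := by
  by_contra hne
  have hlt := (natDegree_lt_iff_degree_lt hne).2 hq
  have h1 := h _ hlt
  rw [freudInner_freudPoly le_rfl] at h1
  exact mul_ne_zero (leadingCoeff_ne_zero.2 hne) (freudNormSq_pos _).ne' h1

theorem freudInner_freudPoly_of_ne {m n : ℕ} (h : m ≠ n) :
    freudInner (freudPoly m) (freudPoly n) = 0 := by
  rcases h.lt_or_gt with h | h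
  · rw [freudInner_comm, freudInner_freudPoly_of_lt (by rwa [natDegree_freudPoly])]
  · rw [freudInner_freudPoly_of_lt (by rwa [natDegree_freudPoly])]

/-! ### Recurrence, derivative and string equation -/

/-- The coefficient `a_n = ‖P_n‖² / ‖P_{n-1}‖²` of the three-term recurrence
`X P_n = P_{n+1} + a_n P_{n-1}`. It is meaningful for `n ≥ 1` only; its value at `0` is `1`. -/
noncomputable def freudCoeff (n : ℕ) : ℝ := freudNormSq n / freudNormSq (n - 1)

theorem freudCoeff_pos (n : ℕ) : 0 < freudCoeff n := div_pos (freudNormSq_pos _) (freudNormSq_pos _)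

theorem freudNormSq_succ (n : ℕ) : freudNormSq (n + 1) = freudCoeff (n + 1) * freudNormSq n := by
  unfold freudCoeff
  rw [Nat.add_sub_cancel, div_mul_cancel₀ _ (freudNormSq_pos n).ne']

theorem coeff_X_pow_mul_freudPoly (k n : ℕ) : (X ^ k * freudPoly n).coeff (n + k) = 1 := by
  rw [coeff_X_pow_mul, freudPoly_coeff_self]

theorem natDegree_X_pow_mul_freudPoly_le (k n : ℕ) : (X ^ k * freudPoly n).natDegree ≤ n + k := by
  refine natDegree_mul_le.trans ?_
  rw [natDegree_freudPoly, natDegree_X_pow, add_comm]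

theorem X_mul_freudPoly (n : ℕ) :
    X * freudPoly (n + 1) = freudPoly (n + 2) + freudCoeff (n + 1) • freudPoly n := by
  have hd : (X * freudPoly (n + 1) - freudPoly (n + 2)
      - freudCoeff (n + 1) • freudPoly n).degree < ((n + 2 : ℕ) : WithBot ℕ) := by
    refine (degree_sub_le _ _).trans_lt (max_lt ?_ ?_)
    · refine degree_sub_lt_of_monic (freudPoly_spec _).1 (natDegree_freudPoly _)
        (monic_X.mul (freudPoly_spec _).1) ?_
      rw [natDegree_X_mul (freudPoly_spec _).1.ne_zero, natDegree_freudPoly]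
    · refine degree_le_natDegree.trans_lt (Nat.cast_lt.2 ((natDegree_smul_le _ _).trans_lt ?_))
      rw [natDegree_freudPoly]; omega
  rw [← sub_eq_zero, ← sub_sub]
  refine eq_zero_of_freudInner_freudPoly hd fun k hk => ?_
  rw [freudInner_sub_right, freudInner_sub_right, freudInner_smul_right,
    freudInner_freudPoly_of_ne hk.ne]
  rcases eq_or_ne k (n + 1) with rfl | h1
  · rw [freudInner_eq_zero_of_hasParity (freudPoly_hasParity _) (freudPoly_hasParity _).X_mul,
      freudInner_freudPoly_of_ne (by omega)]
    simp
  rw [← freudInner_mul_comm, freudInner_comm]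
  rcases eq_or_ne k n with rfl | h2
  · have h3 := natDegree_X_pow_mul_freudPoly_le 1 k
    have h4 := coeff_X_pow_mul_freudPoly 1 k
    rw [pow_one] at h3 h4
    rw [freudInner_freudPoly h3, h4, ← freudNormSq, freudNormSq_succ]
    ring
  · have h3 := natDegree_X_pow_mul_freudPoly_le 1 k
    rw [pow_one] at h3
    rw [freudInner_freudPoly_of_lt (by omega), freudInner_freudPoly_of_ne h2]
    simp

theorem natDegree_derivative_freudPoly_le (n : ℕ) :
    (derivative (freudPoly (n + 1))).natDegree ≤ n := by
  have h := natDegree_derivative_le (freudPoly (n + 1))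
  rwa [natDegree_freudPoly] at h

/-- `P_n'` is a combination of `P_{n-1}` and `P_{n-3}` alone: integration by parts moves the
derivative to a factor `X³`, which shifts the index by at most three. -/
theorem derivative_freudPoly (n : ℕ) :
    derivative (freudPoly (n + 3)) = (n + 3 : ℝ) • freudPoly (n + 2)
      + (4 * freudNormSq (n + 3) / freudNormSq n) • freudPoly n := by
  have h1 := natDegree_derivative_freudPoly_le (n + 2)
  have hd : (derivative (freudPoly (n + 3)) - (n + 3 : ℝ) • freudPoly (n + 2)
      - (4 * freudNormSq (n + 3) / freudNormSq n) • freudPoly n).degree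
        < ((n + 3 : ℕ) : WithBot ℕ) := by
    refine degree_le_natDegree.trans_lt (Nat.cast_lt.2 (Nat.lt_succ_of_le ?_))
    refine (natDegree_sub_le _ _).trans (max_le ((natDegree_sub_le _ _).trans (max_le h1 ?_)) ?_)
    all_goals
      exact (natDegree_smul_le _ _).trans ((natDegree_freudPoly _).le.trans (by omega))
  rw [← sub_eq_zero, ← sub_sub]
  refine eq_zero_of_freudInner_freudPoly hd fun k hk => ?_
  rw [freudInner_sub_right, freudInner_sub_right, freudInner_smul_right, freudInner_smul_right]
  rcases eq_or_ne k (n + 2) with rfl | h2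
  · rw [freudInner_freudPoly_of_ne (m := n + 2) (n := n) (by omega), freudInner_freudPoly h1,
      coeff_derivative, freudPoly_coeff_self, freudNormSq]
    push_cast; ring
  have h3 := natDegree_X_pow_mul_freudPoly_le 3 k
  have h4 : (derivative (freudPoly k)).natDegree < n + 3 := by
    have := natDegree_derivative_le (freudPoly k)
    rw [natDegree_freudPoly] at this
    omega
  rw [freudInner_comm, freudInner_derivative_left, freudInner_freudPoly_of_lt h4,
    freudInner_mul_comm, freudInner_freudPoly_of_ne h2]
  rcases eq_or_ne k (n + 1) with rfl | h5
  · have h6 : HasParity (n + 3 + 1) (X ^ 3 * freudPoly (n + 1)) := by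
      have h := (freudPoly_hasParity (n + 1)).X_mul.X_mul.X_mul
      rwa [← mul_assoc, ← mul_assoc, ← pow_two, ← pow_succ] at h
    rw [freudInner_eq_zero_of_hasParity (freudPoly_hasParity _) h6,
      freudInner_freudPoly_of_ne (by omega)]
    simp
  rcases eq_or_ne k n with rfl | h6
  · rw [freudInner_freudPoly h3, coeff_X_pow_mul_freudPoly, ← freudNormSq,
      div_mul_cancel₀ _ (freudNormSq_pos k).ne']
    ring
  · rw [freudInner_freudPoly_of_lt (by omega), freudInner_freudPoly_of_ne h6]
    simp

/-- The string equation `4 a_n (a_{n+1} + a_n + a_{n-1}) = n`, from the two evaluations of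
`∫ P_n' P_{n-1} exp (-x⁴) dx`: by leading coefficients and by parts. -/
theorem freudCoeff_string (n : ℕ) :
    4 * freudCoeff (n + 2) * (freudCoeff (n + 3) + freudCoeff (n + 2) + freudCoeff (n + 1))
      = n + 2 := by
  have h1 : freudInner (derivative (freudPoly (n + 2))) (freudPoly (n + 1))
      = (n + 2) * freudNormSq (n + 1) := by
    rw [freudInner_comm, freudInner_freudPoly (natDegree_derivative_freudPoly_le (n + 1)),
      coeff_derivative, freudPoly_coeff_self]
    push_cast; ring
  have h2 : (derivative (freudPoly (n + 1))).natDegree < n + 2 := by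
    have := natDegree_derivative_freudPoly_le n
    omega
  have hX : X ^ 3 * freudPoly (n + 2) = X * (X * (X * freudPoly (n + 2))) := by ring
  rw [freudInner_derivative_left, freudInner_freudPoly_of_lt h2, hX, freudInner_mul_comm,
    X_mul_freudPoly (n + 1), X_mul_freudPoly n, mul_add, mul_smul_comm, X_mul_freudPoly n,
    X_mul_freudPoly (n + 2)] at h1
  simp only [freudInner_add_left, freudInner_add_right, freudInner_smul_left,
    freudInner_smul_right, smul_add] at h1
  rw [freudInner_freudPoly_of_ne (m := n + 2 + 2) (n := n + 2) (by omega),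
    freudInner_freudPoly_of_ne (m := n + 2 + 2) (n := n) (by omega),
    freudInner_freudPoly_of_ne (m := n + 2) (n := n) (by omega),
    freudInner_freudPoly_of_ne (m := n) (n := n + 2) (by omega),
    ← freudNormSq, ← freudNormSq, freudNormSq_succ (n + 1), freudNormSq_succ n] at h1
  have h3 := freudNormSq_pos n
  have h4 := freudCoeff_pos (n + 1)
  refine mul_right_cancel₀ (mul_pos h4 h3).ne' ?_
  rw [← h1]
  ring

/-! ### The two-step recurrence of the extremal Sobolev norms -/

theorem sobolevInner_sub_smul_left (c a : ℝ) (p q r : ℝ[X]) :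
    sobolevInner c (p - a • q) r = sobolevInner c p r - a * sobolevInner c q r := by
  simp only [← sobolevForm_apply, map_sub, map_smul, LinearMap.sub_apply, LinearMap.smul_apply,
    smul_eq_mul]

theorem sobolevInner_sub_smul_right (c a : ℝ) (p q r : ℝ[X]) :
    sobolevInner c r (p - a • q) = sobolevInner c r p - a * sobolevInner c r q := by
  simp only [← sobolevForm_apply, map_sub, map_smul, smul_eq_mul]

theorem sobolevInner_sub_right (c : ℝ) (p q r : ℝ[X]) :
    sobolevInner c r (p - q) = sobolevInner c r p - sobolevInner c r q := by
  simp only [← sobolevForm_apply, map_sub]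

theorem natDegree_le_of_degree_lt_succ {n : ℕ} {q : ℝ[X]}
    (h : q.degree < ((n + 1 : ℕ) : WithBot ℕ)) : q.natDegree ≤ n :=
  natDegree_le_iff_coeff_eq_zero.2 fun _ hN => (degree_lt_iff_coeff_zero _ _).1 h _ hN

theorem sobolevInner_freudPoly_of_degree_lt (c : ℝ) {n : ℕ} {q : ℝ[X]}
    (hq : q.degree < ((n + 1 : ℕ) : WithBot ℕ)) : sobolevInner c (freudPoly (n + 3)) q = 0 := by
  rcases eq_or_ne q 0 with rfl | h0
  · simp [← sobolevForm_apply]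
  have h1 : (derivative q).degree < (n : WithBot ℕ) :=
    (degree_derivative_lt h0).trans_le (degree_le_of_natDegree_le
      (natDegree_le_of_degree_lt_succ hq))
  have h2 : (derivative q).degree < ((n + 2 : ℕ) : WithBot ℕ) :=
    h1.trans_le (Nat.cast_le.2 (by omega))
  have h3 : q.degree < ((n + 3 : ℕ) : WithBot ℕ) := hq.trans_le (Nat.cast_le.2 (by omega))
  rw [sobolevInner, derivative_freudPoly, freudInner_add_left, freudInner_smul_left,
    freudInner_smul_left, (freudPoly_spec _).2.2 _ h1, (freudPoly_spec _).2.2 _ h2,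
    (freudPoly_spec _).2.2 _ h3]
  simp

theorem sobolevInner_freudPoly_add_two (c : ℝ) (n : ℕ) :
    sobolevInner c (freudPoly (n + 3)) (freudPoly (n + 1)) =
      4 * c * (n + 1) * freudNormSq (n + 3) := by
  have h1 := natDegree_derivative_freudPoly_le n
  have h2 := (freudNormSq_pos n).ne'
  rw [sobolevInner, derivative_freudPoly, freudInner_add_left, freudInner_smul_left,
    freudInner_smul_left, freudInner_freudPoly h1, freudInner_freudPoly_of_lt (n := n + 2) (by omega),
    freudInner_freudPoly_of_ne (by omega), coeff_derivative, freudPoly_coeff_self]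
  field_simp
  ring

theorem sobolevInner_freudPoly_self (c : ℝ) (n : ℕ) :
    sobolevInner c (freudPoly (n + 3)) (freudPoly (n + 3)) =
      freudNormSq (n + 3) + c * ((n + 3) ^ 2 * freudNormSq (n + 2)
        + 16 * freudNormSq (n + 3) ^ 2 / freudNormSq n) := by
  have h2 := (freudNormSq_pos n).ne'
  rw [sobolevInner, derivative_freudPoly]
  simp only [freudInner_add_left, freudInner_add_right, freudInner_smul_left,
    freudInner_smul_right]
  rw [freudInner_freudPoly_of_ne (m := n + 2) (n := n) (by omega),
    freudInner_freudPoly_of_ne (m := n) (n := n + 2) (by omega), ← freudNormSq, ← freudNormSq,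
    ← freudNormSq]
  field_simp
  ring

/-- In the basis `P_k` the Sobolev form couples `P_{n+3}` only with `P_{n+1}` among lower indices,
so one elimination step produces the minimizer. -/
theorem sobolevPoly_add_three {c : ℝ} (hc : 0 ≤ c) (n : ℕ) :
    sobolevPoly c (n + 3) = freudPoly (n + 3)
      - (sobolevInner c (freudPoly (n + 3)) (freudPoly (n + 1))
        / sobolevInner c (sobolevPoly c (n + 1)) (sobolevPoly c (n + 1)))
          • sobolevPoly c (n + 1) := by
  obtain ⟨hm, hn, -⟩ := sobolevPoly_spec hc (n + 1)
  set S := sobolevPoly c (n + 1) with hSdef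
  set b := sobolevInner c (freudPoly (n + 3)) (freudPoly (n + 1)) / sobolevInner c S S with hb
  have hK := sobolevInner_self_pos hc hm.ne_zero
  have hlt : (b • S).degree < (freudPoly (n + 3)).degree := by
    rw [degree_eq_natDegree (freudPoly_spec (n + 3)).1.ne_zero, natDegree_freudPoly]
    exact degree_le_natDegree.trans_lt
      (Nat.cast_lt.2 ((natDegree_smul_le _ _).trans_lt (by omega)))
  have hSP : sobolevInner c S (freudPoly (n + 1)) = sobolevInner c S S := by
    have h := sobolevInner_sobolevPoly_eq_zero hc
      (degree_sub_lt_of_monic hm hn (freudPoly_spec (n + 1)).1 (natDegree_freudPoly (n + 1)))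
    rw [← hSdef, sobolevInner_sub_right] at h
    linarith
  refine (eq_sobolevPoly hc ((freudPoly_spec _).1.sub_of_left hlt) ?_ fun q hq => ?_).symm
  · rw [natDegree_eq_of_degree_eq (degree_sub_eq_left_of_degree_lt hlt), natDegree_freudPoly]
  have hq2 : q.natDegree ≤ n + 2 := natDegree_le_of_degree_lt_succ hq
  have h1 := degree_sub_coeff_smul_lt (natDegree_freudPoly _).le (freudPoly_coeff_self _) hq2
  set q₁ := q - q.coeff (n + 2) • freudPoly (n + 2) with hq₁
  have hq3 : q₁.natDegree ≤ n + 1 := natDegree_le_of_degree_lt_succ h1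
  have h2 := degree_sub_coeff_smul_lt (natDegree_freudPoly _).le (freudPoly_coeff_self _) hq3
  have e1 : sobolevInner c (freudPoly (n + 3)) (freudPoly (n + 2)) = 0 := by
    rw [sobolevInner_comm]
    exact sobolevInner_eq_zero_of_hasParity c (freudPoly_hasParity _) (freudPoly_hasParity _)
  have e2 : sobolevInner c S (freudPoly (n + 2)) = 0 :=
    sobolevInner_eq_zero_of_hasParity c ((sobolevPoly_spec hc _).hasParity hc)
      (freudPoly_hasParity _)
  have e3 := sobolevInner_freudPoly_of_degree_lt c h2
  have e4 := sobolevInner_sobolevPoly_eq_zero hc h2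
  rw [← hSdef] at e4
  rw [sobolevInner_sub_smul_right, hq₁, sobolevInner_sub_smul_right, ← hq₁] at e3 e4
  have e5 : b * sobolevInner c S S = sobolevInner c (freudPoly (n + 3)) (freudPoly (n + 1)) :=
    div_mul_cancel₀ _ hK.ne'
  rw [sobolevInner_sub_smul_left]
  rw [e1] at e3
  rw [e2, hSP] at e4
  linear_combination e3 - b * e4 - q₁.coeff (n + 1) * e5

theorem sobolevInner_sobolevPoly_add_three {c : ℝ} (hc : 0 ≤ c) (n : ℕ) :
    sobolevInner c (sobolevPoly c (n + 3)) (sobolevPoly c (n + 3)) =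
      sobolevInner c (freudPoly (n + 3)) (freudPoly (n + 3))
        - sobolevInner c (freudPoly (n + 3)) (freudPoly (n + 1)) ^ 2
          / sobolevInner c (sobolevPoly c (n + 1)) (sobolevPoly c (n + 1)) := by
  obtain ⟨hm, hn, -⟩ := sobolevPoly_spec hc (n + 1)
  have hK := sobolevInner_self_pos hc hm.ne_zero
  have hPS : sobolevInner c (freudPoly (n + 3)) (sobolevPoly c (n + 1))
      = sobolevInner c (freudPoly (n + 3)) (freudPoly (n + 1)) := by
    have h := sobolevInner_freudPoly_of_degree_lt c
      (degree_sub_lt_of_monic (freudPoly_spec (n + 1)).1 (natDegree_freudPoly (n + 1)) hm hn)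
    rw [sobolevInner_sub_right] at h
    linarith
  rw [sobolevPoly_add_three hc, sobolevInner_sub_smul_left, sobolevInner_sub_smul_right,
    sobolevInner_sub_smul_right, sobolevInner_comm c (sobolevPoly c (n + 1)) (freudPoly _), hPS]
  field_simp
  ring

theorem normRatio_eq (c : ℝ) (n : ℕ) : normRatio c n =
    sobolevInner c (sobolevPoly c n) (sobolevPoly c n) / freudNormSq n := rfl

/-- For fixed `c` the ratios form a continued fraction in steps of two. -/
theorem normRatio_add_three {c : ℝ} (hc : 0 ≤ c) (n : ℕ) :
    normRatio c (n + 3) = 1 + c * ((n + 3) ^ 2 / freudCoeff (n + 3)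
        + 16 * freudCoeff (n + 3) * freudCoeff (n + 2) * freudCoeff (n + 1))
      - c ^ 2 * (16 * (n + 1) ^ 2 * freudCoeff (n + 3) * freudCoeff (n + 2))
        / normRatio c (n + 1) := by
  have hK := sobolevInner_self_pos hc (sobolevPoly_spec hc (n + 1)).1.ne_zero
  rw [normRatio_eq, normRatio_eq, sobolevInner_sobolevPoly_add_three hc,
    sobolevInner_freudPoly_self, sobolevInner_freudPoly_add_two]
  set K := sobolevInner c (sobolevPoly c (n + 1)) (sobolevPoly c (n + 1))
  have h0 := freudNormSq_pos n
  have h1 := freudCoeff_pos (n + 1)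
  have h2 := freudCoeff_pos (n + 2)
  have h3 := freudCoeff_pos (n + 3)
  rw [freudNormSq_succ (n + 2), freudNormSq_succ (n + 1), freudNormSq_succ n]
  field_simp
  ring

/-- The minimizer has norm at least `‖P_n‖`, and its derivative at least `n ‖P_{n-1}‖`. -/
theorem one_add_le_normRatio {c : ℝ} (hc : 0 ≤ c) (n : ℕ) :
    1 + c * ((n + 1) ^ 2 / freudCoeff (n + 1)) ≤ normRatio c (n + 1) := by
  obtain ⟨hm, hn, -⟩ := sobolevPoly_spec hc (n + 1)
  rw [normRatio_eq, le_div_iff₀ (freudNormSq_pos _), sobolevInner]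
  set S := sobolevPoly c (n + 1)
  have h1 := sq_coeff_mul_freudNormSq_le hn.le
  have h2 : (derivative S).natDegree ≤ n := (natDegree_derivative_le S).trans (by omega)
  have h3 := sq_coeff_mul_freudNormSq_le h2
  have h4 : S.coeff (n + 1) = 1 := hn ▸ hm.coeff_natDegree
  rw [coeff_derivative, h4, one_mul] at h3
  rw [h4, one_pow, one_mul] at h1
  have h5 : (1 + c * ((n + 1) ^ 2 / freudCoeff (n + 1))) * freudNormSq (n + 1)
      = freudNormSq (n + 1) + c * ((n + 1) ^ 2 * freudNormSq n) := by
    rw [freudNormSq_succ]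
    have := (freudCoeff_pos (n + 1)).ne'
    field_simp
  rw [h5]
  exact add_le_add h1 (mul_le_mul_of_nonneg_left h3 hc)

/-! ### Asymptotics of the recurrence coefficients -/

/-- Freud's argument: with `A = liminf s` and `B = limsup s`, evaluating the string equation near
`B` and near `A` gives `B (B + 2 A) ≤ 1 / 4 ≤ A (A + 2 B)`, whence `B ≤ A`. -/
theorem tendsto_of_string_equation {s u v : ℕ → ℝ} (h0 : ∀ᶠ n in atTop, 0 ≤ s n)
    (h1 : ∀ᶠ n in atTop, s n ≤ 1 / 2)
    (hu : Tendsto (fun n => u n - s (n + 1)) atTop (𝓝 0))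
    (hv : Tendsto (fun n => v n - s (n - 1)) atTop (𝓝 0))
    (h : ∀ᶠ n in atTop, 4 * s n * (u n + s n + v n) = 1) :
    Tendsto s atTop (𝓝 (1 / √12)) := by
  have hbu : IsBoundedUnder (· ≤ ·) atTop s := ⟨1 / 2, by simpa using h1⟩
  have hbl : IsBoundedUnder (· ≥ ·) atTop s := ⟨0, by simpa using h0⟩
  set A := liminf s atTop with hA
  set B := limsup s atTop with hB
  have hA0 : 0 ≤ A := le_liminf_of_le hbu.isCoboundedUnder_ge h0
  have hAB : A ≤ B := liminf_le_limsup hbu hbl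
  have hB0 : 0 ≤ B := hA0.trans hAB
  have hB1 : B ≤ 1 / 2 := limsup_le_of_le hbl.isCoboundedUnder_le h1
  have hlow : ∀ ε > 0, ∀ᶠ n in atTop, A - ε < s n := fun ε hε =>
    eventually_lt_of_lt_liminf (by linarith) hbl
  have hupp : ∀ ε > 0, ∀ᶠ n in atTop, s n < B + ε := fun ε hε =>
    eventually_lt_of_limsup_lt (by linarith) hbu
  have hsub : Tendsto (fun n : ℕ => n - 1) atTop atTop := tendsto_sub_atTop_nat 1
  have hnb : ∀ ε > 0, ∀ᶠ n in atTop,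
      2 * A - 4 * ε < u n + v n ∧ u n + v n < 2 * B + 4 * ε := fun ε hε => by
    filter_upwards [(tendsto_add_atTop_nat 1).eventually (hlow ε hε),
      (tendsto_add_atTop_nat 1).eventually (hupp ε hε), hsub.eventually (hlow ε hε),
      hsub.eventually (hupp ε hε), (Metric.tendsto_nhds.1 hu) ε hε,
      (Metric.tendsto_nhds.1 hv) ε hε] with n a1 a2 a3 a4 a5 a6
    rw [Real.dist_eq, sub_zero, abs_lt] at a5 a6
    constructor <;> linarith
  have key : ∀ ε > 0, B ^ 2 + 2 * A * B - 4 * ε ≤ 1 / 4 := fun ε hε => by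
    have hf : ∃ᶠ n in atTop, B - ε < s n :=
      frequently_lt_of_lt_limsup hbl.isCoboundedUnder_le (by linarith)
    obtain ⟨n, hn, a0, a1, a2, a3, -⟩ := (hf.and_eventually
      (h0.and (h1.and (h.and (hnb ε hε))))).exists
    nlinarith [mul_nonneg a0 (sub_nonneg.2 a3.le), sq_nonneg (s n - B),
      mul_nonneg hA0 (sub_nonneg.2 hn.le), mul_nonneg hB0 (sub_nonneg.2 hn.le)]
  have key' : ∀ ε > 0, 1 / 4 ≤ (A + ε) * (A + ε + (2 * B + 4 * ε)) := fun ε hε => by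
    have hf : ∃ᶠ n in atTop, s n < A + ε :=
      frequently_lt_of_liminf_lt hbu.isCoboundedUnder_ge (by linarith)
    obtain ⟨n, hn, a0, a2, -, a3⟩ := (hf.and_eventually
      (h0.and (h.and (hnb ε hε)))).exists
    have : s n * (u n + s n + v n) ≤ (A + ε) * (A + ε + (2 * B + 4 * ε)) :=
      (mul_le_mul_of_nonneg_left (by linarith) a0).trans
        (mul_le_mul_of_nonneg_right hn.le (by linarith))
    linarith
  have l1 : B ^ 2 + 2 * A * B ≤ 1 / 4 := le_of_forall_pos_le_add fun ε hε => by
    linarith [key (ε / 4) (by linarith)]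
  have l2 : 1 / 4 ≤ A * (A + 2 * B) := by
    have ht : Tendsto (fun ε : ℝ => (A + ε) * (A + ε + (2 * B + 4 * ε))) (𝓝[>] 0)
        (𝓝 ((A + 0) * (A + 0 + (2 * B + 4 * 0)))) :=
      ((by fun_prop : Continuous fun ε : ℝ =>
        (A + ε) * (A + ε + (2 * B + 4 * ε))).tendsto 0).mono_left nhdsWithin_le_nhds
    have := ge_of_tendsto ht (by filter_upwards [self_mem_nhdsWithin] with ε hε using key' ε hε)
    simpa using this
  have hEq : A = B := le_antisymm hAB (by nlinarith)
  have hval : B = 1 / √12 := by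
    rw [eq_div_iff (by positivity), ← sq_eq_sq₀ (by positivity) (by norm_num), mul_pow,
      Real.sq_sqrt (by norm_num)]
    rw [hEq] at l1 l2
    nlinarith
  rw [← hval]
  exact tendsto_of_liminf_eq_limsup hEq rfl hbu hbl

theorem freudCoeff_sq_le {n : ℕ} (hn : 2 ≤ n) : 4 * freudCoeff n ^ 2 ≤ n := by
  obtain ⟨m, rfl⟩ := Nat.exists_eq_add_of_le' hn
  have h := freudCoeff_string m
  push_cast
  nlinarith [mul_pos (freudCoeff_pos (m + 2)) (freudCoeff_pos (m + 3)),
    mul_pos (freudCoeff_pos (m + 2)) (freudCoeff_pos (m + 1))]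

theorem tendsto_sqrt_sub_div_sqrt (k : ℕ) :
    Tendsto (fun n : ℕ => √((n - k : ℕ) : ℝ) / √n) atTop (𝓝 1) := by
  have h : Tendsto (fun n : ℕ => 1 - (k : ℝ) / (n : ℝ)) atTop (𝓝 (1 - 0)) :=
    tendsto_const_nhds.sub (tendsto_const_div_atTop_nhds_zero_nat _)
  have h2 := (Real.continuous_sqrt.tendsto _).comp h
  rw [sub_zero, Real.sqrt_one] at h2
  refine h2.congr' ?_
  filter_upwards [eventually_gt_atTop k] with n hn
  have : (n : ℝ) ≠ 0 := Nat.cast_ne_zero.2 (by omega)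
  rw [← Real.sqrt_div (by positivity), Nat.cast_sub hn.le, sub_div, div_self this]
  rfl

/-- `a_n ~ √(n / 12)`. -/
theorem tendsto_freudCoeff_div_sqrt :
    Tendsto (fun n : ℕ => freudCoeff n / √n) atTop (𝓝 (1 / √12)) := by
  have h1 : ∀ n : ℕ, 2 ≤ n → freudCoeff n / √n ≤ 1 / 2 := fun n hn => by
    have h := freudCoeff_sq_le hn
    have hn0 : (0 : ℝ) < n := by positivity
    rw [div_le_iff₀ (Real.sqrt_pos.2 hn0)]
    refine le_of_sq_le_sq ?_ (by positivity)
    rw [mul_pow, Real.sq_sqrt hn0.le]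
    linarith
  have h0 : ∀ n : ℕ, 0 ≤ freudCoeff n / √n := fun n =>
    div_nonneg (freudCoeff_pos n).le (Real.sqrt_nonneg _)
  have hd : ∀ (t r : ℕ → ℝ), (∀ n, 0 ≤ t n) → (∀ᶠ n in atTop, t n ≤ 1 / 2) →
      Tendsto r atTop (𝓝 1) → Tendsto (fun n => t n * (r n - 1)) atTop (𝓝 0) :=
    fun t r ht0 ht hr => by
      refine bdd_le_mul_tendsto_zero' (1 / 2) ?_ (by simpa using hr.sub_const 1)
      filter_upwards [ht] with n hn
      rw [abs_of_nonneg (ht0 n)]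
      exact hn
  have hsub : Tendsto (fun n : ℕ => n - 1) atTop atTop := tendsto_sub_atTop_nat 1
  refine tendsto_of_string_equation (u := fun n => freudCoeff (n + 1) / √n)
    (v := fun n => freudCoeff (n - 1) / √n) (.of_forall h0)
    (eventually_atTop.2 ⟨2, h1⟩) ?_ ?_ ?_
  · refine (hd (fun n => freudCoeff (n + 1) / √(n + 1 : ℕ)) _ (fun n => h0 _)
      (eventually_atTop.2 ⟨2, fun n hn => h1 (n + 1) (by omega)⟩)
      (by simpa using ((tendsto_sqrt_sub_div_sqrt 1).comp
        (tendsto_add_atTop_nat 1)).inv₀ one_ne_zero)).congr' ?_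
    filter_upwards [eventually_gt_atTop 0] with n hn
    have hn0 : (0 : ℝ) < n := by positivity
    have h3 : √(n : ℝ) ≠ 0 := (Real.sqrt_pos.2 hn0).ne'
    have h4 : √(n + 1 : ℝ) ≠ 0 := by positivity
    push_cast
    field_simp
  · refine (hd (fun n => freudCoeff (n - 1) / √(n - 1 : ℕ)) _ (fun n => h0 _)
      (eventually_atTop.2 ⟨3, fun n hn => h1 (n - 1) (by omega)⟩)
      (tendsto_sqrt_sub_div_sqrt 1)).congr' ?_
    filter_upwards [eventually_gt_atTop 1] with n hn
    obtain ⟨m, rfl⟩ := Nat.exists_eq_add_of_le' hn.le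
    have hm0 : (0 : ℝ) < m := by
      have : 0 < m := by omega
      positivity
    have h3 : √(m : ℝ) ≠ 0 := (Real.sqrt_pos.2 hm0).ne'
    have h4 : √(m + 1 : ℝ) ≠ 0 := by positivity
    rw [Nat.add_sub_cancel]
    push_cast
    field_simp
  · filter_upwards [eventually_ge_atTop 2] with n hn
    obtain ⟨m, rfl⟩ := Nat.exists_eq_add_of_le' hn
    have h := freudCoeff_string m
    have h5 : √((m + 2 : ℕ) : ℝ) ^ 2 = m + 2 := by
      rw [Real.sq_sqrt (by positivity)]; push_cast; ring
    have h4 : √((m + 2 : ℕ) : ℝ) ≠ 0 := by positivity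
    rw [show m + 2 - 1 = m + 1 by omega]
    field_simp
    rw [h5]
    linarith

theorem tendsto_freudCoeff_sub_div_sqrt (k : ℕ) :
    Tendsto (fun n : ℕ => freudCoeff (n - k) / √n) atTop (𝓝 (1 / √12)) := by
  have h := (tendsto_freudCoeff_div_sqrt.comp (tendsto_sub_atTop_nat k)).mul
    (tendsto_sqrt_sub_div_sqrt k)
  rw [mul_one] at h
  refine h.congr' ?_
  filter_upwards [eventually_gt_atTop k] with n hn
  have : √((n - k : ℕ) : ℝ) ≠ 0 :=
    (Real.sqrt_pos.2 (Nat.cast_pos.2 (Nat.sub_pos_of_lt hn))).ne'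
  simp only [Function.comp]
  field_simp

/-! ### Coefficients of the two-step recurrence -/

/-- `‖P_n'‖² / ‖P_n‖²` for `n ≥ 3`, in terms of the recurrence coefficients. -/
noncomputable def derivativeNormRatio (n : ℕ) : ℝ :=
  (n : ℝ) ^ 2 / freudCoeff n + 16 * freudCoeff n * freudCoeff (n - 1) * freudCoeff (n - 2)

/-- `⟨P_n', P_{n-2}'⟩² / (‖P_n‖² ‖P_{n-2}‖²)` for `n ≥ 3`, in terms of the recurrence
coefficients. -/
noncomputable def derivativeCoupling (n : ℕ) : ℝ :=
  16 * ((n - 2 : ℕ) : ℝ) ^ 2 * freudCoeff n * freudCoeff (n - 1)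

theorem derivativeCoupling_nonneg (n : ℕ) : 0 ≤ derivativeCoupling n := by
  have h1 := freudCoeff_pos n
  have h2 := freudCoeff_pos (n - 1)
  unfold derivativeCoupling
  positivity

theorem normRatio_recurrence {c : ℝ} (hc : 0 ≤ c) {n : ℕ} (hn : 3 ≤ n) :
    normRatio c n =
      1 + c * derivativeNormRatio n - c ^ 2 * derivativeCoupling n / normRatio c (n - 2) := by
  obtain ⟨m, rfl⟩ := Nat.exists_eq_add_of_le' hn
  rw [normRatio_add_three hc, derivativeNormRatio, derivativeCoupling,
    show m + 3 - 1 = m + 2 by omega, show m + 3 - 2 = m + 1 by omega]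
  push_cast
  rfl

theorem one_add_sq_div_le_normRatio {c : ℝ} (hc : 0 ≤ c) {n : ℕ} (hn : 1 ≤ n) :
    1 + c * ((n : ℝ) ^ 2 / freudCoeff n) ≤ normRatio c n := by
  obtain ⟨m, rfl⟩ := Nat.exists_eq_add_of_le' hn
  have h := one_add_le_normRatio hc m
  push_cast
  exact h

theorem one_le_normRatio {c : ℝ} (hc : 0 ≤ c) {n : ℕ} (hn : 1 ≤ n) : 1 ≤ normRatio c n := by
  have h := one_add_sq_div_le_normRatio hc hn
  have h1 := freudCoeff_pos n
  have : 0 ≤ c * ((n : ℝ) ^ 2 / freudCoeff n) := by positivity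
  linarith

theorem sq_div_div_sqrt_cube {x a : ℝ} (hx : 0 < x) : x ^ 2 / a / √x ^ 3 = (a / √x)⁻¹ := by
  have h : √x ≠ 0 := (Real.sqrt_pos.2 hx).ne'
  have h2 : x ^ 2 = √x ^ 4 := by
    rw [show (4 : ℕ) = 2 * 2 from rfl, pow_mul, Real.sq_sqrt hx.le]
  rw [h2, inv_div]
  field_simp

theorem tendsto_sq_div_freudCoeff :
    Tendsto (fun n : ℕ => (n : ℝ) ^ 2 / freudCoeff n / √n ^ 3) atTop (𝓝 √12) := by
  have h := tendsto_freudCoeff_div_sqrt.inv₀ (by positivity)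
  rw [one_div, inv_inv] at h
  refine h.congr' ?_
  filter_upwards [eventually_gt_atTop 0] with n hn
  rw [sq_div_div_sqrt_cube (by positivity)]

theorem sqrt_twelve : √12 = 2 * √3 := by
  rw [show (12 : ℝ) = 2 ^ 2 * 3 by norm_num, Real.sqrt_mul (by norm_num), Real.sqrt_sq (by norm_num)]

theorem tendsto_derivativeNormRatio :
    Tendsto (fun n : ℕ => derivativeNormRatio n / √n ^ 3) atTop (𝓝 (20 / (3 * √3))) := by
  have h := tendsto_sq_div_freudCoeff.add
    (((tendsto_freudCoeff_div_sqrt.mul (tendsto_freudCoeff_sub_div_sqrt 1)).mul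
      (tendsto_freudCoeff_sub_div_sqrt 2)).const_mul 16)
  have h3 : √3 ^ 2 = 3 := Real.sq_sqrt (by norm_num)
  have h4 : √12 + 16 * (1 / √12 * (1 / √12) * (1 / √12)) = 20 / (3 * √3) := by
    rw [sqrt_twelve]
    field_simp
    rw [show √3 ^ 4 = (√3 ^ 2) ^ 2 by ring, h3]
    norm_num
  rw [h4] at h
  refine h.congr fun n => ?_
  rw [derivativeNormRatio]
  ring

theorem tendsto_derivativeCoupling :
    Tendsto (fun n : ℕ => derivativeCoupling n / (√n ^ 3) ^ 2) atTop (𝓝 (4 / 3)) := by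
  have h := ((((tendsto_sqrt_sub_div_sqrt 2).pow 4).mul
    (tendsto_freudCoeff_div_sqrt)).mul (tendsto_freudCoeff_sub_div_sqrt 1)).const_mul 16
  have h4 : 16 * (1 ^ 4 * (1 / √12) * (1 / √12)) = (4 / 3 : ℝ) := by
    have h3 : √12 ^ 2 = 12 := Real.sq_sqrt (by norm_num)
    field_simp
    rw [h3]
    norm_num
  rw [h4] at h
  refine h.congr fun n => ?_
  have h5 : √((n - 2 : ℕ) : ℝ) ^ 4 = ((n - 2 : ℕ) : ℝ) ^ 2 := by
    rw [show (4 : ℕ) = 2 * 2 from rfl, pow_mul, Real.sq_sqrt (by positivity)]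
  rw [derivativeCoupling, div_pow, h5]
  ring

/-! ### Convergence of the continued fraction -/

/-- If `k_i = b_i - d_i / k_{i+1}` with `b_i → β`, `d_i → δ`, and all `k_i` stay above `y` where
`t ↦ β - δ / t` contracts, then every `k_i` tends to the fixed point of this map above `y`. -/
theorem tendsto_of_continued_fraction {k b d : ℕ → ℕ → ℝ} {β δ x y : ℝ}
    (hb : ∀ i, Tendsto (b i) atTop (𝓝 β)) (hd : ∀ i, Tendsto (d i) atTop (𝓝 δ))
    (hd0 : ∀ i n, 0 ≤ d i n) (hk : ∀ i, ∀ᶠ n in atTop, k i n = b i n - d i n / k (i + 1) n)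
    (hy : 0 < y) (hlow : ∀ i, ∀ᶠ n in atTop, y ≤ k i n) (hyx : y ≤ x) (hx : x = β - δ / x)
    (hδ0 : 0 ≤ δ) (hδ : δ ≤ y ^ 2 / 4) (i : ℕ) : Tendsto (k i) atTop (𝓝 x) := by
  have hx0 : 0 < x := hy.trans_le hyx
  have hβ : x ≤ β := by
    have : 0 ≤ δ / x := by positivity
    linarith
  have hupp : ∀ i, ∀ᶠ n in atTop, k i n ≤ β + 1 := fun i => by
    filter_upwards [hk i, hlow (i + 1), (hb i).eventually (gt_mem_nhds (lt_add_one β))]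
      with n h1 h2 h3
    have : 0 ≤ d i n / k (i + 1) n := div_nonneg (hd0 i n) (hy.le.trans h2)
    linarith
  set C := β + 1 + x
  have hC : 0 < C := by linarith
  -- each step of the recurrence halves the bound on the distance to the fixed point
  have key : ∀ j i, ∀ᶠ n in atTop, |k i n - x| ≤ C / 2 ^ j := by
    intro j
    induction j with
    | zero =>
      intro i
      filter_upwards [hupp i, hlow i] with n h1 h2
      rw [pow_zero, div_one, abs_le]
      constructor <;> linarith
    | succ j ih =>
      intro i
      have he : 0 < C / 2 ^ j := by positivity
      filter_upwards [hk i, hlow (i + 1), ih (i + 1),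
        Metric.tendsto_nhds.1 (hb i) (C / 2 ^ j / 8) (by positivity),
        Metric.tendsto_nhds.1 (hd i) (y * (C / 2 ^ j / 8)) (by positivity)] with n h1 h2 h3 h4 h5
      rw [Real.dist_eq] at h4 h5
      set e := C / 2 ^ j
      set t := k (i + 1) n
      have ht : 0 < t := hy.trans_le h2
      have hkx : k i n - x = (b i n - β) - (d i n - δ) / t + δ / (t * x) * (t - x) := by
        rw [h1]
        nth_rewrite 1 [hx]
        field_simp
        ring
      have e1 : |(d i n - δ) / t| ≤ e / 8 := by
        rw [abs_div, abs_of_pos ht, div_le_iff₀ ht]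
        nlinarith
      have e2 : |δ / (t * x) * (t - x)| ≤ 1 / 4 * e := by
        rw [abs_mul, abs_of_nonneg (by positivity)]
        refine mul_le_mul ?_ h3 (abs_nonneg _) (by norm_num)
        rw [div_le_iff₀ (by positivity)]
        nlinarith [mul_le_mul h2 hyx hy.le ht.le]
      have e3 : C / 2 ^ (j + 1) = e / 2 := by rw [pow_succ, ← div_div]
      rw [hkx, e3]
      have a1 := abs_add_le ((b i n - β) - (d i n - δ) / t) (δ / (t * x) * (t - x))
      have a2 := abs_sub (b i n - β) ((d i n - δ) / t)
      linarith
  rw [Metric.tendsto_nhds]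
  intro ε hε
  obtain ⟨j, hj⟩ := exists_pow_lt_of_lt_one (div_pos hε hC) (by norm_num : (1 / 2 : ℝ) < 1)
  filter_upwards [key j i] with n hn
  rw [Real.dist_eq]
  refine hn.trans_lt ?_
  rw [lt_div_iff₀ hC] at hj
  calc C / 2 ^ j = (1 / 2) ^ j * C := by rw [one_div, inv_pow]; ring
    _ < ε := hj

theorem rpow_three_halves (n : ℕ) : (n : ℝ) ^ (3 / 2 : ℝ) = √n ^ 3 := by
  rw [Real.sqrt_eq_rpow, ← Real.rpow_natCast, ← Real.rpow_mul (Nat.cast_nonneg n)]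
  norm_num

/-- The limit in the theorem is the larger fixed point of `t ↦ 1 + 20 L / (3 √3) - (4 / 3) L² / t`;
it is at least three times `r = 2 L / √3`, because `z ≥ 5 / 3` gives `φ(z) ≥ 3`. -/
theorem joukowskiPhi_fixedPoint {L : ℝ} (hL : 0 < L) :
    let x := 2 * L / √3 * joukowskiPhi ((20 * L + 3 * √3) / (12 * L))
    3 * (2 * L / √3) ≤ x ∧ x = 1 + L * (20 / (3 * √3)) - L ^ 2 * (4 / 3) / x := by
  intro x
  have hs : 0 < √3 := by positivity
  have h3 : √3 ^ 2 = 3 := Real.sq_sqrt (by norm_num)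
  have hr : 0 < 2 * L / √3 := by positivity
  set r := 2 * L / √3 with hrdef
  set z := (20 * L + 3 * √3) / (12 * L) with hz
  have hz1 : 5 / 3 ≤ z := by
    rw [hz, le_div_iff₀ (by positivity)]
    linarith
  have hw2 : √(z ^ 2 - 1) ^ 2 = z ^ 2 - 1 := Real.sq_sqrt (by nlinarith)
  have hw1 : 4 / 3 ≤ √(z ^ 2 - 1) := Real.le_sqrt_of_sq_le (by nlinarith)
  have hx : x = r * (z + √(z ^ 2 - 1)) := rfl
  have hge : 3 * r ≤ x := by rw [hx]; nlinarith
  refine ⟨hge, ?_⟩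
  have hx0 : 0 < x := by linarith
  have hβ : 1 + L * (20 / (3 * √3)) = 2 * r * z := by
    rw [hrdef, hz]
    field_simp
    ring
  have hδ : L ^ 2 * (4 / 3) = r ^ 2 := by
    rw [hrdef, div_pow, h3]
    ring
  rw [hβ, hδ, eq_sub_iff_add_eq]
  have : x * x + r ^ 2 = 2 * r * z * x := by
    rw [hx]
    linear_combination r ^ 2 * hw2
  field_simp
  linarith

/-- For `L ∈ (0, ∞)` the continued fraction is run down from index `n` with `c = λ_n` fixed; a bounded
number of steps does not change the limit of `n^{3/2} λ_n`. -/
theorem tendsto_normRatio_of_pos {lam : ℕ → ℝ} (hpos : ∀ n, 1 ≤ n → 0 < lam n) {L : ℝ} (hL : 0 < L)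
    (h : Tendsto (fun n : ℕ => √n ^ 3 * lam n) atTop (𝓝 L)) :
    Tendsto (fun n : ℕ => normRatio (lam n) n) atTop
      (𝓝 (2 * L / √3 * joukowskiPhi ((20 * L + 3 * √3) / (12 * L)))) := by
  have hsub : ∀ i, Tendsto (fun n : ℕ => n - 2 * i) atTop atTop := fun i =>
    tendsto_sub_atTop_nat (2 * i)
  have hlam : ∀ i, Tendsto (fun n : ℕ => √((n - 2 * i : ℕ) : ℝ) ^ 3 * lam n) atTop (𝓝 L) :=
    fun i => by
      have h1 := ((tendsto_sqrt_sub_div_sqrt (2 * i)).pow 3).mul h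
      rw [one_pow, one_mul] at h1
      refine h1.congr' ?_
      filter_upwards [eventually_gt_atTop 0] with n hn
      have : √(n : ℝ) ≠ 0 := by positivity
      field_simp
  have hmul : ∀ (f : ℕ → ℝ) (l : ℝ) (i : ℕ), Tendsto (fun n : ℕ => f n / √n ^ 3) atTop (𝓝 l) →
      Tendsto (fun n : ℕ => lam n * f (n - 2 * i)) atTop (𝓝 (L * l)) := fun f l i hf => by
    refine ((hlam i).mul (hf.comp (hsub i))).congr' ?_
    filter_upwards [eventually_gt_atTop (2 * i)] with n hn
    have : √((n - 2 * i : ℕ) : ℝ) ≠ 0 :=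
      (Real.sqrt_pos.2 (Nat.cast_pos.2 (Nat.sub_pos_of_lt hn))).ne'
    simp only [Function.comp]
    field_simp
  obtain ⟨hx1, hx2⟩ := joukowskiPhi_fixedPoint hL
  have hr : 0 < 2 * L / √3 := by positivity
  have h3 : √3 ^ 2 = 3 := Real.sq_sqrt (by norm_num)
  refine tendsto_of_continued_fraction (k := fun i n => normRatio (lam n) (n - 2 * i))
    (b := fun i n => 1 + lam n * derivativeNormRatio (n - 2 * i))
    (d := fun i n => lam n ^ 2 * derivativeCoupling (n - 2 * i)) (fun i => ?_) (fun i => ?_)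
    (fun i n => mul_nonneg (sq_nonneg _) (derivativeCoupling_nonneg _)) (fun i => ?_)
    (by positivity) (fun i => ?_) hx1 hx2 (by positivity) ?_ 0
  · exact (hmul _ _ i tendsto_derivativeNormRatio).const_add 1
  · refine (((hlam i).pow 2).mul (tendsto_derivativeCoupling.comp (hsub i))).congr' ?_
    filter_upwards [eventually_gt_atTop (2 * i)] with n hn
    have : √((n - 2 * i : ℕ) : ℝ) ≠ 0 :=
      (Real.sqrt_pos.2 (Nat.cast_pos.2 (Nat.sub_pos_of_lt hn))).ne'
    simp only [Function.comp]
    field_simp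
  · filter_upwards [eventually_ge_atTop (2 * i + 3)] with n hn
    have h1 := normRatio_recurrence (hpos n (by omega)).le (n := n - 2 * i) (by omega)
    rwa [Nat.sub_sub, show 2 * i + 2 = 2 * (i + 1) by ring] at h1
  · have h1 := (hmul _ _ i tendsto_sq_div_freudCoeff).const_add 1
    have h2 : 3 * (2 * L / √3) < 1 + L * √12 := by
      have : 3 * (2 * L / √3) = L * √12 := by
        rw [sqrt_twelve]
        field_simp
        rw [h3]
      linarith
    filter_upwards [h1.eventually (lt_mem_nhds h2), eventually_gt_atTop (2 * i)] with n a1 a2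
    exact a1.le.trans (one_add_sq_div_le_normRatio (hpos n (by omega)).le (by omega))
  · have : (2 * L / √3) ^ 2 = L ^ 2 * (4 / 3) := by
      rw [div_pow, h3]; ring
    nlinarith [sq_nonneg L]

/-! ### The three regimes -/

theorem proposition1 (lam : ℕ → ℝ)
    (hpos : ∀ n, 1 ≤ n → 0 < lam n)
    (hanti : ∀ m n, 1 ≤ m → m ≤ n → lam n ≤ lam m)
    (hratio : Tendsto (fun n : ℕ => lam (n - 2) / lam n) atTop (𝓝 1)) :
    (Tendsto (fun n : ℕ => (n : ℝ) ^ (3 / 2 : ℝ) * lam n) atTop (𝓝 0) →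
      Tendsto (fun n : ℕ => normRatio (lam n) n) atTop (𝓝 1)) ∧
    (∀ L : ℝ, 0 < L →
      Tendsto (fun n : ℕ => (n : ℝ) ^ (3 / 2 : ℝ) * lam n) atTop (𝓝 L) →
      Tendsto (fun n : ℕ => normRatio (lam n) n) atTop
        (𝓝 (2 * L / √3 * joukowskiPhi ((20 * L + 3 * √3) / (12 * L))))) ∧
    (Tendsto (fun n : ℕ => (n : ℝ) ^ (3 / 2 : ℝ) * lam n) atTop atTop →
      Tendsto (fun n : ℕ => normRatio (lam n) n) atTop atTop) := by
  simp only [rpow_three_halves]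
  refine ⟨fun h => ?_, fun L hL h => tendsto_normRatio_of_pos hpos hL h, fun h => ?_⟩
  · have h1 := (h.mul tendsto_derivativeNormRatio).const_add 1
    rw [zero_mul, add_zero] at h1
    refine tendsto_of_tendsto_of_tendsto_of_le_of_le' tendsto_const_nhds h1 ?_ ?_
    · filter_upwards [eventually_ge_atTop 1] with n hn
      exact one_le_normRatio (hpos n hn).le hn
    · filter_upwards [eventually_ge_atTop 3] with n hn
      have hc := (hpos n (by omega)).le
      have h2 : √(n : ℝ) ≠ 0 := by positivity
      have h3 : √(n : ℝ) ^ 3 * lam n * (derivativeNormRatio n / √n ^ 3)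
          = lam n * derivativeNormRatio n := by
        field_simp
      have h4 : 0 ≤ lam n ^ 2 * derivativeCoupling n / normRatio (lam n) (n - 2) :=
        div_nonneg (mul_nonneg (sq_nonneg _) (derivativeCoupling_nonneg n))
          (zero_le_one.trans (one_le_normRatio hc (by omega)))
      rw [h3, normRatio_recurrence hc hn]
      linarith
  · refine tendsto_atTop_mono' atTop ?_ (h.atTop_mul_pos (by positivity) tendsto_sq_div_freudCoeff)
    filter_upwards [eventually_ge_atTop 1] with n hn
    have h2 : √(n : ℝ) ≠ 0 := by positivity
    have h3 : √(n : ℝ) ^ 3 * lam n * ((n : ℝ) ^ 2 / freudCoeff n / √n ^ 3)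
        = lam n * ((n : ℝ) ^ 2 / freudCoeff n) := by
      field_simp
    rw [h3]
    linarith [one_add_sq_div_le_normRatio (hpos n hn).le hn]
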